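/- Let $n\ge 0$, $N=\{0,1,\dots,n\}$, let $e_0,\dots,e_n$ be the standard basis of $\mathbb R^N$ and $e_S=\sum_{i\in S}e_i$ for $S\subseteq N$. Let $G$ be a graph on the vertex set $N$ (a subgraph of the complete graph $K_{n+1}$) with edge set $U(G)$. For an edge $u=(i,j)$, $i<j$, put $t(u)=e_i-e_j$, and let $\delta_u:2^N\to\mathbb R$ be the function with $\delta_u(S)=1$ if exactly one end of $u$ lies in $S$ and $\delta_u(S)=0$ otherwise. For real weights $b=(b_u)_{u\in U(G)}$ put $$\beta_{G,b}=\sum_{u\in U(G)}b_u\delta_u,\qquad D_b(G)=\sum_{u\in U(G)}b_u\,t(u)t(u)^T,$$ $$Z_b(G)=\sum_{u\in U(G)}b_u\{\lambda t(u):-1\le\lambda\le1\}\quad\text{(Minkowski sum)}.$$ A cut function is a function $\beta_{K_{n+1},b}$ with all $b_u\ge0$. For a cut function $\beta$ let $$P(\beta)=\{x\in\mathbb R^N:\ \textstyle\sum_{i\in S}x_i\le\beta(S)\text{ for all }S\subset N,\ \sum_{i\in N}x_i=0\}.$$ Two polytopes have the same type if their face lattices are isomorphic. The type domain of $P(\beta_0)$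 is the connected component containing $\beta_0$ of the set of all cut functions $\beta$ such that $P(\beta)$ has the same type as $P(\beta_0)$. Its dimension is the non-rigidity degree of $P(\beta_0)$. Let $\mathcal C(G)=\{\beta_{G,b}: b_u>0 \text{ for all }u\in U(G)\}$. Let Voronoi's principal domain be the set of the quadratic forms $\sum_{0\le i<j\le n}b_{ij}(x_i-x_j)^2$, with all $b_{ij}>0$, on the hyperplane $\{x\in\mathbb R^N:\sum_{i\in N}x_i=0\}$. Then: 1. All functions in $\mathcal C(G)$ are submodular. The functions $\delta_u$, $u\in U(G)$, are linearly independent, and $\mathcal C(G)$ is the simplicial cone of their linear combinations with positive coefficients. It equals its own relative interior, and $\dim\mathcal C(G)=|U(G)|$. 2. For all weights with $b_u>0$ for every $u\in U(G)$ we have $Z_b(G)=P(\beta_{G,b})$, the type domain of $Z_b(G)$ is $\mathcal C(G)$, and hence its non-rigidity degree is $|U(G)|$. 3. For all real weights $b$ and all $S\subseteq N$ we have $\beta_{G,b}(S)=e_S^TD_b(G)e_S$. The set $F(G)$ of the quadratic forms $\sum_{u\in U(G)}b_u\langle t(u),x\rangle^2$ with all $b_u\ge0$, on the same hyperplane, is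 a face of the closure of the principal domain. There is a linear map from the quadratic forms on the hyperplane to the set functions on $2^N$ which, for every graph $H\subseteq K_{n+1}$ and all real weights $b$ on $U(H)$, sends the form $x^TD_b(H)x$ to the function $S\mapsto e_S^TD_b(H)e_S$. It maps $F(G)$ bijectively onto the closure of $\mathcal C(G)$, and the relative interior of $F(G)$ bijectively onto $\mathcal C(G)$. -/

import Mathlib

open scoped Pointwise Matrix

noncomputable section

namespace CutCone

/-- Real set functions `2^N → ℝ` on `N = {0, …, n}`. -/
abbrev SetFun (n : ℕ) : Type := Finset (Fin (n + 1)) → ℝ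

/-- The incidence vector `e_S`. -/
def incVec {n : ℕ} (S : Finset (Fin (n + 1))) : Fin (n + 1) → ℝ :=
  ∑ i ∈ S, Pi.single i 1

/-- The root `t(u) = e_i - e_j` of an edge `u = (i, j)` with `i < j`. -/
def root {n : ℕ} (u : Sym2 (Fin (n + 1))) : Fin (n + 1) → ℝ :=
  Pi.single u.inf 1 - Pi.single u.sup 1

/-- The edge `u` has one end in `S` and the other end outside `S`. -/
def Cuts {n : ℕ} (S : Finset (Fin (n + 1))) (u : Sym2 (Fin (n + 1))) : Prop :=
  (∃ i ∈ u, i ∈ S) ∧ ∃ j ∈ u, j ∉ S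

open scoped Classical in
/-- The set function `δ_u`. -/
def cutIndicator {n : ℕ} (u : Sym2 (Fin (n + 1))) : SetFun n :=
  fun S => if Cuts S u then 1 else 0

open scoped Classical in
/-- The cut function `S ↦ ∑ b_u`, summed over the edges `u` of `G` that are cut by `S`.
The values of `b` outside the edge set of `G` are irrelevant. -/
def cutFun {n : ℕ} (G : SimpleGraph (Fin (n + 1))) (b : Sym2 (Fin (n + 1)) → ℝ) : SetFun n :=
  fun S => ∑ u ∈ G.edgeFinset with Cuts S u, b u

/-- All cut functions: those of nonnegative weights on the edges of `K_{n+1}`. -/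
def cutFunctions (n : ℕ) : Set (SetFun n) :=
  {β | ∃ b : Sym2 (Fin (n + 1)) → ℝ,
    (∀ u ∈ (⊤ : SimpleGraph (Fin (n + 1))).edgeSet, 0 ≤ b u) ∧ β = cutFun ⊤ b}

/-- The cone `C(G)`: cut functions with positive weights exactly on the edges of `G`. -/
def cutCone {n : ℕ} (G : SimpleGraph (Fin (n + 1))) : Set (SetFun n) :=
  {β | ∃ b : Sym2 (Fin (n + 1)) → ℝ, (∀ u ∈ G.edgeSet, 0 < b u) ∧ β = cutFun G b}

/-- Submodularity of a set function. -/
def IsSubmodular {n : ℕ} (β : SetFun n) : Prop :=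
  ∀ S T : Finset (Fin (n + 1)), β (S ∩ T) + β (S ∪ T) ≤ β S + β T

/-- The base polytope `P(β)`. -/
def basePolytope {n : ℕ} (β : SetFun n) : Set (Fin (n + 1) → ℝ) :=
  {x | (∀ S : Finset (Fin (n + 1)), S ⊂ Finset.univ → ∑ i ∈ S, x i ≤ β S) ∧ ∑ i, x i = 0}

/-- The segment `z(t)` from `-t` to `t`. -/
def zSegment {n : ℕ} (t : Fin (n + 1) → ℝ) : Set (Fin (n + 1) → ℝ) :=
  {x | ∃ c ∈ Set.Icc (-1 : ℝ) 1, x = c • t}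

open scoped Classical in
/-- The zonotope `Z_b(G)`, the Minkowski sum of the segments `b_u z(t(u))`, `u` an edge of `G`. -/
def zonotope {n : ℕ} (G : SimpleGraph (Fin (n + 1))) (b : Sym2 (Fin (n + 1)) → ℝ) :
    Set (Fin (n + 1) → ℝ) :=
  ∑ u ∈ G.edgeFinset, b u • zSegment (root u)

/-- The faces of a polytope (the empty face and the polytope itself included), ordered by
inclusion. -/
abbrev Face {n : ℕ} (P : Set (Fin (n + 1) → ℝ)) : Type :=
  {F : Set (Fin (n + 1) → ℝ) // IsExposed ℝ P F}

/-- Two polytopes have the same type: their face lattices are isomorphic. -/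
def SameType {n : ℕ} (P Q : Set (Fin (n + 1) → ℝ)) : Prop :=
  Nonempty (Face P ≃o Face Q)

/-- The type domain of `P(β₀)`: the connected component of `β₀` in the set of all cut functions
`β` for which `P(β)` has the type of `P(β₀)`. -/
def typeDomain {n : ℕ} (β₀ : SetFun n) : Set (SetFun n) :=
  connectedComponentIn {β ∈ cutFunctions n | SameType (basePolytope β) (basePolytope β₀)} β₀

/-- Dimension of a set in a real vector space: the dimension of its affine hull. -/
def affDim {E : Type*} [AddCommGroup E] [Module ℝ E] (A : Set E) : ℕ :=
  Module.finrank ℝ (vectorSpan ℝ A)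

/-- The non-rigidity degree of `P(β)`. -/
def nonRigidityDegree {n : ℕ} (β : SetFun n) : ℕ := affDim (typeDomain β)

/-- The hyperplane `∑ x_i = 0` of `ℝ^N`. -/
def zeroSum (n : ℕ) : Submodule ℝ (Fin (n + 1) → ℝ) where
  carrier := {x | ∑ i, x i = 0}
  zero_mem' := by simp
  add_mem' := by
    intro x y hx hy
    simp only [Set.mem_ofPred_eq] at hx hy ⊢
    simp [Finset.sum_add_distrib, hx, hy]
  smul_mem' := by
    intro c x hx
    simp only [Set.mem_ofPred_eq] at hx ⊢
    simp [← Finset.mul_sum, hx]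

/-- Quadratic forms in `n` variables, realised on the hyperplane `∑ x_i = 0` of `ℝ^N`. -/
abbrev Form (n : ℕ) : Type := QuadraticForm ℝ (zeroSum n)

/-- The usual topology of the finite-dimensional space of quadratic forms, obtained from
pointwise convergence. -/
instance formTopology (n : ℕ) : TopologicalSpace (Form n) :=
  TopologicalSpace.induced (fun (f : Form n) (x : zeroSum n) => f x) inferInstance

/-- The quadratic form `x ↦ xᵀ D x` on the hyperplane. -/
def gramForm {n : ℕ} (D : Matrix (Fin (n + 1)) (Fin (n + 1)) ℝ) : Form n :=
  D.toQuadraticForm'.comp (zeroSum n).subtype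

open scoped Classical in
/-- The matrix `D_b(G) = ∑ b_u t(u) t(u)ᵀ`, summed over the edges of `G`. -/
def gramMatrix {n : ℕ} (G : SimpleGraph (Fin (n + 1))) (b : Sym2 (Fin (n + 1)) → ℝ) :
    Matrix (Fin (n + 1)) (Fin (n + 1)) ℝ :=
  ∑ u ∈ G.edgeFinset, b u • Matrix.vecMulVec (root u) (root u)

open scoped Classical in
/-- `f(x) = ∑ b_u ⟨t(u), x⟩²`, summed over the edges of `G`. -/
def IsRootSum {n : ℕ} (G : SimpleGraph (Fin (n + 1))) (b : Sym2 (Fin (n + 1)) → ℝ)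
    (f : Form n) : Prop :=
  ∀ x : zeroSum n, f x = ∑ u ∈ G.edgeFinset, b u * (root u ⬝ᵥ (x : Fin (n + 1) → ℝ)) ^ 2

/-- Voronoi's principal domain: the forms `∑_{i<j} b_{ij} (x_i - x_j)²` with all `b_{ij} > 0`. -/
def principalDomain (n : ℕ) : Set (Form n) :=
  {f | ∃ b : Sym2 (Fin (n + 1)) → ℝ,
    (∀ u ∈ (⊤ : SimpleGraph (Fin (n + 1))).edgeSet, 0 < b u) ∧ IsRootSum ⊤ b f}

/-- The forms `∑ b_u ⟨t(u), x⟩²` over the edges `u` of `G`, with all `b_u ≥ 0`. -/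
def graphFace {n : ℕ} (G : SimpleGraph (Fin (n + 1))) : Set (Form n) :=
  {f | ∃ b : Sym2 (Fin (n + 1)) → ℝ, (∀ u ∈ G.edgeSet, 0 ≤ b u) ∧ IsRootSum G b f}

end CutCone

end

/-! Everything rests on three observations. Coordinates: for an edge with ends `i`, `j` the
functional `β ↦ (β{i} + β{j} - β{i,j}) / 2` is dual to the functions `δ_u`
(`isDualTo_cutIndicator`). This makes the cones simplicial and gives their dimension, closure and
relative interior. Polytopes: `∑ b_u |⟨t(u), l⟩|` is the support function of the zonotope, and its
value at `l = e_S` is the cut function. The base polytope obeys the same bound for every `l` (Lovász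
extension), whence the equality `basePolytope_cutFun_eq_zonotope`. A nonempty face is given by the
signs of some `l` on the edges, so the type depends only on the graph (`sameType_zonotope`).
Deleting edges merges faces, so nested distinct graphs have different types (`not_sameType_of_lt`).
Unrelated graphs, for instance isomorphic ones, may share a type; hence the type domain is a
component, and `typeDomain_cutFun` shows that the cone is connected and clopen among the cut
functions of its type. Forms: `⟨t(u), e_S⟩` is `-1`, `0` or `1`, so its square is its absolute
value. Evaluation at the projections of the `e_S` therefore sends `⟨t(u), x⟩²` to `δ_u`, and the
cones of forms go to the cones of cut functions. -/

noncomputable section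

namespace CutCone

/-! ### Simplicial cones -/

section SimplicialCone

variable {ι V : Type*} [Fintype ι] [AddCommGroup V] [Module ℝ V]

/-- The combinations of the vectors `v i` with positive coefficients. -/
def posCone (v : ι → V) : Set V :=
  {x | ∃ c : ι → ℝ, (∀ i, 0 < c i) ∧ x = ∑ i, c i • v i}

/-- The combinations of the vectors `v i` with nonnegative coefficients. -/
def nonnegCone (v : ι → V) : Set V :=
  {x | ∃ c : ι → ℝ, (∀ i, 0 ≤ c i) ∧ x = ∑ i, c i • v i}

lemma posCone_subset_nonnegCone (v : ι → V) : posCone v ⊆ nonnegCone v := by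
  rintro x ⟨c, hc, rfl⟩
  exact ⟨c, fun i => (hc i).le, rfl⟩

lemma convex_posCone (v : ι → V) : Convex ℝ (posCone v) := by
  rintro _ ⟨c, hc, rfl⟩ _ ⟨d, hd, rfl⟩ s t hs ht hst
  refine ⟨fun i => s * c i + t * d i, fun i => ?_, ?_⟩
  · rcases hs.eq_or_lt with rfl | hs
    · have : t = 1 := by linarith
      simp [this, hd i]
    · exact add_pos_of_pos_of_nonneg (mul_pos hs (hc i)) (mul_nonneg ht (hd i).le)
  · simp [Finset.smul_sum, ← Finset.sum_add_distrib, add_smul, smul_smul]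

/-- The functionals `k` are dual to the vectors `v`. -/
def IsDualTo (k : ι → V →ₗ[ℝ] ℝ) (v : ι → V) : Prop :=
  (∀ i, k i (v i) = 1) ∧ ∀ i j, i ≠ j → k i (v j) = 0

variable {v : ι → V} {k : ι → V →ₗ[ℝ] ℝ}

lemma IsDualTo.apply_sum (h : IsDualTo k v) (c : ι → ℝ) (i : ι) :
    k i (∑ j, c j • v j) = c i := by
  rw [map_sum, Finset.sum_eq_single i]
  · simp [h.1]
  · intro j _ hj
    simp [h.2 i j hj.symm]
  · simp

lemma IsDualTo.linearIndependent (h : IsDualTo k v) : LinearIndependent ℝ v := by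
  rw [Fintype.linearIndependent_iff]
  intro g hg i
  rw [← h.apply_sum g i, hg, map_zero]

lemma IsDualTo.mem_nonnegCone_iff (h : IsDualTo k v) {x : V} :
    x ∈ nonnegCone v ↔ (∀ i, 0 ≤ k i x) ∧ x = ∑ i, k i x • v i := by
  constructor
  · rintro ⟨c, hc, rfl⟩
    simp [h.apply_sum, hc]
  · rintro ⟨h1, h2⟩
    exact ⟨_, h1, h2⟩

lemma IsDualTo.mem_posCone_iff (h : IsDualTo k v) {x : V} :
    x ∈ posCone v ↔ (∀ i, 0 < k i x) ∧ x = ∑ i, k i x • v i := by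
  constructor
  · rintro ⟨c, hc, rfl⟩
    simp [h.apply_sum, hc]
  · rintro ⟨h1, h2⟩
    exact ⟨_, h1, h2⟩

lemma affDim_posCone (h : LinearIndependent ℝ v) : affDim (posCone v) = Fintype.card ι := by
  have hs : vectorSpan ℝ (posCone v) = Submodule.span ℝ (Set.range v) := by
    classical
    apply le_antisymm
    · rw [vectorSpan_def, Submodule.span_le]
      rintro _ ⟨_, ⟨c, hc, rfl⟩, _, ⟨d, hd, rfl⟩, rfl⟩
      exact Submodule.sub_mem _
        (Submodule.sum_mem _ fun i _ => Submodule.smul_mem _ _ (Submodule.subset_span ⟨i, rfl⟩))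
        (Submodule.sum_mem _ fun i _ => Submodule.smul_mem _ _ (Submodule.subset_span ⟨i, rfl⟩))
    · rw [Submodule.span_le]
      rintro _ ⟨i, rfl⟩
      -- Each `v i` is a difference of two points of the open cone.
      have h1 : (∑ j, v j) ∈ posCone v := ⟨fun _ => 1, by simp, by simp⟩
      have h2 : (v i + ∑ j, v j) ∈ posCone v := by
        refine ⟨fun j => (if j = i then 1 else 0) + 1, fun j => by dsimp only; split_ifs <;> norm_num, ?_⟩
        simp [add_smul, Finset.sum_add_distrib]
      simpa using vsub_mem_vectorSpan ℝ h2 h1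
  rw [affDim, hs, finrank_span_eq_card h]

/-- The linear map `x ↦ x - ∑ k_i(x) v_i` vanishes on the cone, hence on the affine span of any
subset. -/
lemma affineSpan_subset_of_subset_nonnegCone (h : IsDualTo k v) {s : Set V}
    (hs : s ⊆ nonnegCone v) {x : V} (hx : x ∈ affineSpan ℝ s) : x = ∑ i, k i x • v i := by
  let f : V →ₗ[ℝ] V := LinearMap.id - ∑ i, (k i).smulRight (v i)
  have hf : ∀ y, f y = y - ∑ i, k i y • v i := fun y => by simp [f]
  have h1 : affineSpan ℝ s ≤ (LinearMap.ker f).toAffineSubspace := by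
    rw [affineSpan_le]
    intro y hy
    have := (h.mem_nonnegCone_iff.1 (hs hy)).2
    change f y = 0
    rw [hf, ← this, sub_self]
  have h2 : f x = 0 := h1 hx
  rw [hf] at h2
  exact sub_eq_zero.1 h2

variable [TopologicalSpace V]

/-- Within the affine span the open cone is cut out by finitely many open conditions `k_i > 0`. -/
lemma posCone_subset_intrinsicInterior (h : IsDualTo k v) (hk : ∀ i, Continuous (k i)) {s : Set V}
    (hs1 : posCone v ⊆ s) (hs2 : s ⊆ nonnegCone v) : posCone v ⊆ intrinsicInterior ℝ s := by
  intro x hx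
  rw [mem_intrinsicInterior]
  refine ⟨⟨x, subset_affineSpan ℝ s (hs1 hx)⟩, ?_, rfl⟩
  rw [mem_interior]
  refine ⟨{y | ∀ i, 0 < k i (y : V)}, ?_, ?_, (h.mem_posCone_iff.1 hx).1⟩
  · intro y hy
    exact hs1 (h.mem_posCone_iff.2 ⟨hy, affineSpan_subset_of_subset_nonnegCone h hs2 y.2⟩)
  · rw [Set.ofPred_forall]
    exact isOpen_iInter_of_finite fun i =>
      isOpen_lt continuous_const ((hk i).comp continuous_subtype_val)

lemma intrinsicInterior_posCone (h : IsDualTo k v) (hk : ∀ i, Continuous (k i)) :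
    intrinsicInterior ℝ (posCone v) = posCone v :=
  intrinsicInterior_subset.antisymm
    (posCone_subset_intrinsicInterior h hk subset_rfl (posCone_subset_nonnegCone v))

variable [IsTopologicalAddGroup V] [ContinuousSMul ℝ V]

/-- If `k_i` vanishes at `y`, the points `y - t v_i` with small `t > 0` stay in the affine span but
have `k_i = -t < 0`, so `y` is not a relative interior point. -/
lemma intrinsicInterior_nonnegCone (h : IsDualTo k v) (hk : ∀ i, Continuous (k i)) :
    intrinsicInterior ℝ (nonnegCone v) = posCone v := by
  refine Set.Subset.antisymm ?_
    (posCone_subset_intrinsicInterior h hk (posCone_subset_nonnegCone v) subset_rfl)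
  intro x hx
  have hx0 := h.mem_nonnegCone_iff.1 (intrinsicInterior_subset hx)
  refine h.mem_posCone_iff.2 ⟨fun i => lt_of_le_of_ne (hx0.1 i) fun h0 => ?_, hx0.2⟩
  obtain ⟨y, hy, rfl⟩ := mem_intrinsicInterior.1 hx
  have hv : (y : V) + v i ∈ nonnegCone v := by
    classical
    refine ⟨fun j => k j y + if j = i then 1 else 0, fun j => ?_, ?_⟩
    · have := hx0.1 j
      dsimp only
      split_ifs <;> linarith
    · simp only [add_smul, Finset.sum_add_distrib, ← hx0.2]
      simp
  have hmem : ∀ t : ℝ, (y : V) - t • v i ∈ affineSpan ℝ (nonnegCone v) := by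
    intro t
    have := AffineMap.lineMap_mem (-t) y.2 (subset_affineSpan ℝ _ hv)
    rw [AffineMap.lineMap_apply] at this
    simpa [sub_eq_add_neg, add_comm] using this
  let p : ℝ → affineSpan ℝ (nonnegCone v) := fun t => ⟨(y : V) - t • v i, hmem t⟩
  have hp : Continuous p := by
    apply Continuous.subtype_mk
    fun_prop
  have hp0 : p 0 = y := by simp [p]
  have hnear : ∀ᶠ t in nhds (0 : ℝ), p t ∈ (Subtype.val ⁻¹' nonnegCone v : Set _) := by
    apply hp.continuousAt.eventually
    rw [hp0]
    exact mem_interior_iff_mem_nhds.1 hy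
  have hpos : ∀ᶠ t in nhdsWithin (0 : ℝ) (Set.Ioi 0), 0 < t := self_mem_nhdsWithin
  obtain ⟨t, ht, hpt⟩ := (hpos.and (hnear.filter_mono nhdsWithin_le_nhds)).exists
  have := (h.mem_nonnegCone_iff.1 hpt).1 i
  simp only [p, map_sub, map_smul, h.1, smul_eq_mul, mul_one, ← h0] at this
  linarith

lemma closure_posCone [T2Space V] (h : IsDualTo k v) (hk : ∀ i, Continuous (k i)) :
    closure (posCone v) = nonnegCone v := by
  apply Set.Subset.antisymm
  · refine closure_minimal (posCone_subset_nonnegCone v) ?_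
    have : nonnegCone v = {x | ∀ i, 0 ≤ k i x} ∩ {x | x = ∑ i, k i x • v i} := by
      ext x
      exact h.mem_nonnegCone_iff
    rw [this, Set.ofPred_forall]
    exact (isClosed_iInter fun i => isClosed_le continuous_const (hk i)).inter
      (isClosed_eq continuous_id (by fun_prop))
  · rintro x ⟨c, hc, rfl⟩
    have ht : Filter.Tendsto (fun t : ℝ => ∑ i, (c i + t) • v i) (nhdsWithin 0 (Set.Ioi 0))
        (nhds (∑ i, c i • v i)) := by
      have : Continuous fun t : ℝ => ∑ i, (c i + t) • v i := by fun_prop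
      simpa using (this.tendsto 0).mono_left nhdsWithin_le_nhds
    refine mem_closure_of_tendsto ht ?_
    filter_upwards [self_mem_nhdsWithin] with t ht
    exact ⟨fun i => c i + t, fun i => add_pos_of_nonneg_of_pos (hc i) ht, rfl⟩

end SimplicialCone

/-! ### Linear maps between simplicial cones -/

section Transport

variable {ι V W : Type*} [Fintype ι] [AddCommGroup V] [Module ℝ V] [AddCommGroup W] [Module ℝ W]
  {v : ι → V} {w : ι → W} {k : ι → W →ₗ[ℝ] ℝ}

/-- Dual functionals are needed only on the target: they recover the coefficients after `f` is
applied. -/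
lemma IsDualTo.bijOn_nonnegCone (h : IsDualTo k w) {f : V →ₗ[ℝ] W} (hf : ∀ i, f (v i) = w i) :
    Set.BijOn f (nonnegCone v) (nonnegCone w) := by
  have hs : ∀ c : ι → ℝ, f (∑ i, c i • v i) = ∑ i, c i • w i := fun c => by simp [hf]
  refine ⟨?_, ?_, ?_⟩
  · rintro _ ⟨c, hc, rfl⟩
    exact ⟨c, hc, hs c⟩
  · rintro _ ⟨c, hc, rfl⟩ _ ⟨d, hd, rfl⟩ he
    rw [hs, hs] at he
    have : c = d := by
      funext i
      rw [← h.apply_sum c i, he, h.apply_sum]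
    rw [this]
  · rintro _ ⟨c, hc, rfl⟩
    exact ⟨_, ⟨c, hc, rfl⟩, hs c⟩

lemma IsDualTo.bijOn_posCone (h : IsDualTo k w) {f : V →ₗ[ℝ] W} (hf : ∀ i, f (v i) = w i) :
    Set.BijOn f (posCone v) (posCone w) := by
  have hs : ∀ c : ι → ℝ, f (∑ i, c i • v i) = ∑ i, c i • w i := fun c => by simp [hf]
  refine ⟨?_, (h.bijOn_nonnegCone hf).injOn.mono (posCone_subset_nonnegCone v), ?_⟩
  · rintro _ ⟨c, hc, rfl⟩
    exact ⟨c, hc, hs c⟩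
  · rintro _ ⟨c, hc, rfl⟩
    exact ⟨_, ⟨c, hc, rfl⟩, hs c⟩

end Transport

/-! ### Cut functions and root forms -/

variable {n : ℕ}

lemma incVec_apply (S : Finset (Fin (n + 1))) (i : Fin (n + 1)) [Decidable (i ∈ S)] :
    incVec S i = if i ∈ S then 1 else 0 := by
  classical
  simp [incVec, Finset.sum_apply, Pi.single_apply]

lemma root_dotProduct (u : Sym2 (Fin (n + 1))) (x : Fin (n + 1) → ℝ) :
    root u ⬝ᵥ x = x u.inf - x u.sup := by
  simp [root, sub_dotProduct]

lemma mk_inf_sup (u : Sym2 (Fin (n + 1))) : s(u.inf, u.sup) = u := by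
  induction u with | _ i j
  rcases le_total i j with h | h <;> simp [h, Sym2.eq_swap]

lemma cuts_iff (S : Finset (Fin (n + 1))) (u : Sym2 (Fin (n + 1))) :
    Cuts S u ↔ ¬(u.inf ∈ S ↔ u.sup ∈ S) := by
  conv_lhs => rw [← mk_inf_sup u]
  simp only [Cuts, Sym2.mem_iff, exists_eq_or_imp, exists_eq_left]
  tauto

/-- The square serves the quadratic forms, the absolute value in `cutIndicator_eq_abs` the support
function of the zonotope. -/
lemma cutIndicator_eq_sq (u : Sym2 (Fin (n + 1))) (S : Finset (Fin (n + 1))) :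
    cutIndicator u S = (root u ⬝ᵥ incVec S) ^ 2 := by
  classical
  rw [root_dotProduct, incVec_apply, incVec_apply, cutIndicator]
  simp only [cuts_iff]
  by_cases h1 : u.inf ∈ S <;> by_cases h2 : u.sup ∈ S <;> simp [h1, h2]

lemma cutIndicator_eq_abs (u : Sym2 (Fin (n + 1))) (S : Finset (Fin (n + 1))) :
    cutIndicator u S = |root u ⬝ᵥ incVec S| := by
  classical
  rw [root_dotProduct, incVec_apply, incVec_apply, cutIndicator]
  simp only [cuts_iff]
  by_cases h1 : u.inf ∈ S <;> by_cases h2 : u.sup ∈ S <;> simp [h1, h2]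

lemma inf_ne_sup_of_not_isDiag {u : Sym2 (Fin (n + 1))} (h : ¬u.IsDiag) : u.inf ≠ u.sup := by
  rw [← mk_inf_sup u] at h
  simpa using h

lemma inf_ne_sup_of_mem_edgeSet {G : SimpleGraph (Fin (n + 1))} {u : Sym2 (Fin (n + 1))}
    (h : u ∈ G.edgeSet) : u.inf ≠ u.sup :=
  inf_ne_sup_of_not_isDiag (G.not_isDiag_of_mem_edgeSet h)

/-- The functional on set functions that reads off the coefficient of `δ_u`. -/
def edgeCoef (u : Sym2 (Fin (n + 1))) : SetFun n →ₗ[ℝ] ℝ :=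
  (1 / 2 : ℝ) • (LinearMap.proj (R := ℝ) (φ := fun _ => ℝ) ({u.inf} : Finset (Fin (n + 1))) +
    LinearMap.proj {u.sup} - LinearMap.proj {u.inf, u.sup})

lemma edgeCoef_apply (u : Sym2 (Fin (n + 1))) (β : SetFun n) :
    edgeCoef u β = 1 / 2 * (β {u.inf} + β {u.sup} - β {u.inf, u.sup}) := by
  simp [edgeCoef]

lemma continuous_edgeCoef (u : Sym2 (Fin (n + 1))) : Continuous (edgeCoef u) := by
  have : ⇑(edgeCoef u) = fun β => 1 / 2 * (β {u.inf} + β {u.sup} - β {u.inf, u.sup}) :=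
    funext (edgeCoef_apply u)
  rw [this]
  fun_prop

lemma edgeCoef_cutIndicator_self {u : Sym2 (Fin (n + 1))} (h : u.inf ≠ u.sup) :
    edgeCoef u (cutIndicator u) = 1 := by
  simp only [edgeCoef_apply, cutIndicator, cuts_iff, Finset.mem_insert, Finset.mem_singleton]
  simp [h, h.symm]
  norm_num

/-- If `v ≠ u` is cut by one end of `u`, then its other end is outside `u`, so the pair cuts it too
and the two contributions cancel. A loop is never cut. -/
lemma edgeCoef_cutIndicator_of_ne {u v : Sym2 (Fin (n + 1))} (hu : u.inf ≠ u.sup)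
    (h : u ≠ v) : edgeCoef u (cutIndicator v) = 0 := by
  have h1 : u.inf ≤ u.sup := Sym2.inf_le_sup u
  have h2 : v.inf ≤ v.sup := Sym2.inf_le_sup v
  have h3 : ¬(u.inf = v.inf ∧ u.sup = v.sup) := fun h' =>
    h (Sym2.inf_eq_inf_and_sup_eq_sup.1 h')
  simp only [edgeCoef_apply, cutIndicator, cuts_iff, Finset.mem_insert, Finset.mem_singleton]
  generalize u.inf = a at *
  generalize u.sup = b at *
  generalize v.inf = c at *
  generalize v.sup = d at *
  by_cases h4 : c = a <;> by_cases h5 : c = b <;> by_cases h6 : d = a <;>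
    by_cases h7 : d = b <;> simp_all
  all_goals order

lemma isDualTo_cutIndicator (G : SimpleGraph (Fin (n + 1))) :
    IsDualTo (fun u : G.edgeSet => edgeCoef (u : Sym2 (Fin (n + 1))))
      (fun u : G.edgeSet => cutIndicator (u : Sym2 (Fin (n + 1)))) :=
  ⟨fun u => edgeCoef_cutIndicator_self (inf_ne_sup_of_mem_edgeSet u.2),
    fun u _ h => edgeCoef_cutIndicator_of_ne (inf_ne_sup_of_mem_edgeSet u.2)
      fun h' => h (Subtype.ext h')⟩

open scoped Classical in
lemma exists_edge_weights_iff (G : SimpleGraph (Fin (n + 1))) {V : Type*} [AddCommGroup V]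
    [Module ℝ V] (v : Sym2 (Fin (n + 1)) → V) (p : ℝ → Prop) (x : V) :
    (∃ b : Sym2 (Fin (n + 1)) → ℝ, (∀ u ∈ G.edgeSet, p (b u)) ∧
      x = ∑ u ∈ G.edgeFinset, b u • v u) ↔
    ∃ c : G.edgeSet → ℝ, (∀ u, p (c u)) ∧ x = ∑ u, c u • v u := by
  have hs : ∀ f : Sym2 (Fin (n + 1)) → V,
      ∑ u ∈ G.edgeFinset, f u = ∑ u : G.edgeSet, f u := fun f =>
    (Finset.sum_subtype _ (fun u => SimpleGraph.mem_edgeFinset) f)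
  constructor
  · rintro ⟨b, hb, rfl⟩
    exact ⟨fun u => b u, fun u => hb u u.2, hs _⟩
  · rintro ⟨c, hc, rfl⟩
    refine ⟨fun u => if h : u ∈ G.edgeSet then c ⟨u, h⟩ else 0, fun u hu => by simp [hu, hc], ?_⟩
    rw [hs]
    exact Finset.sum_congr rfl fun u _ => by simp

open scoped Classical in
lemma cutFun_eq_sum (G : SimpleGraph (Fin (n + 1))) (b : Sym2 (Fin (n + 1)) → ℝ) :
    cutFun G b = ∑ u ∈ G.edgeFinset, b u • cutIndicator u := by
  ext S
  simp [cutFun, cutIndicator, Finset.sum_filter, Finset.sum_apply]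

open scoped Classical in
lemma cutCone_eq_posCone (G : SimpleGraph (Fin (n + 1))) :
    cutCone G = posCone (fun u : G.edgeSet => cutIndicator (u : Sym2 (Fin (n + 1)))) := by
  ext β
  simp only [cutCone, cutFun_eq_sum]
  exact exists_edge_weights_iff G _ (0 < ·) β

lemma cutIndicator_submodular (u : Sym2 (Fin (n + 1))) : IsSubmodular (cutIndicator u) := by
  intro S T
  simp only [cutIndicator, cuts_iff, Finset.mem_inter, Finset.mem_union]
  by_cases h1 : u.inf ∈ S <;> by_cases h2 : u.inf ∈ T <;> by_cases h3 : u.sup ∈ S <;>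
    by_cases h4 : u.sup ∈ T <;> simp [h1, h2, h3, h4]

lemma isSubmodular_of_mem_cutCone {G : SimpleGraph (Fin (n + 1))} {β : SetFun n}
    (hβ : β ∈ cutCone G) : IsSubmodular β := by
  classical
  obtain ⟨b, hb, rfl⟩ := hβ
  intro S T
  simp only [cutFun_eq_sum, Finset.sum_apply, Pi.smul_apply, smul_eq_mul,
    ← Finset.sum_add_distrib, ← mul_add]
  exact Finset.sum_le_sum fun u hu => mul_le_mul_of_nonneg_left
    (cutIndicator_submodular u S T) (hb u (SimpleGraph.mem_edgeFinset.1 hu)).le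

lemma dotProduct_gramMatrix_mulVec (G : SimpleGraph (Fin (n + 1)))
    (b : Sym2 (Fin (n + 1)) → ℝ) (x : Fin (n + 1) → ℝ) [Fintype G.edgeSet] :
    x ⬝ᵥ (gramMatrix G b *ᵥ x) = ∑ u ∈ G.edgeFinset, b u * (root u ⬝ᵥ x) ^ 2 := by
  simp only [gramMatrix, Matrix.sum_mulVec, dotProduct_sum, Matrix.smul_mulVec,
    Matrix.vecMulVec_mulVec, dotProduct_smul, smul_eq_mul,
    MulOpposite.smul_eq_mul_unop, MulOpposite.unop_op]
  refine Finset.sum_congr (by congr!) fun u _ => ?_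
  rw [dotProduct_comm x]
  ring

lemma cutFun_eq_gram (G : SimpleGraph (Fin (n + 1))) (b : Sym2 (Fin (n + 1)) → ℝ)
    (S : Finset (Fin (n + 1))) :
    cutFun G b S = incVec S ⬝ᵥ (gramMatrix G b *ᵥ incVec S) := by
  classical
  simp only [dotProduct_gramMatrix_mulVec, cutFun_eq_sum, Finset.sum_apply, Pi.smul_apply,
    smul_eq_mul, cutIndicator_eq_sq]

/-! ### Quadratic forms on the hyperplane -/

/-- The orthogonal projection of `x` to the hyperplane `∑ x_i = 0`. -/
def centered (x : Fin (n + 1) → ℝ) : zeroSum n :=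
  ⟨fun i => x i - (∑ j, x j) / (n + 1), by
    have : (n + 1 : ℝ) ≠ 0 := by positivity
    change ∑ i, (x i - (∑ j, x j) / (n + 1)) = 0
    simp [Finset.sum_sub_distrib]
    field_simp
    ring⟩

/-- Roots are orthogonal to constant vectors; this lets `e_S` be replaced by a point of the
hyperplane. -/
lemma root_dotProduct_centered (u : Sym2 (Fin (n + 1))) (x : Fin (n + 1) → ℝ) :
    root u ⬝ᵥ (centered x : Fin (n + 1) → ℝ) = root u ⬝ᵥ x := by
  simp [root_dotProduct, centered]

/-- The form `x ↦ ⟨t(u), x⟩²`. -/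
def rootForm (u : Sym2 (Fin (n + 1))) : Form n :=
  QuadraticMap.sq.comp
    ((LinearMap.proj (R := ℝ) (φ := fun _ => ℝ) u.inf - LinearMap.proj u.sup) ∘ₗ (zeroSum n).subtype)

lemma rootForm_apply (u : Sym2 (Fin (n + 1))) (x : zeroSum n) :
    rootForm u x = (root u ⬝ᵥ (x : Fin (n + 1) → ℝ)) ^ 2 := by
  simp [rootForm, root_dotProduct, sq]

/-- The linear map that evaluates a form at the projections of the vectors `e_S`. -/
def evalCuts (n : ℕ) : Form n →ₗ[ℝ] SetFun n where
  toFun f S := f (centered (incVec S))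
  map_add' _ _ := rfl
  map_smul' _ _ := rfl

lemma evalCuts_apply (f : Form n) (S : Finset (Fin (n + 1))) :
    evalCuts n f S = f (centered (incVec S)) := rfl

lemma evalCuts_rootForm (u : Sym2 (Fin (n + 1))) : evalCuts n (rootForm u) = cutIndicator u := by
  ext S
  rw [evalCuts_apply, rootForm_apply, root_dotProduct_centered, cutIndicator_eq_sq]

lemma gramForm_apply (D : Matrix (Fin (n + 1)) (Fin (n + 1)) ℝ) (x : zeroSum n) :
    gramForm D x = (x : Fin (n + 1) → ℝ) ⬝ᵥ (D *ᵥ (x : Fin (n + 1) → ℝ)) := by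
  simp [gramForm, Matrix.toQuadraticForm', Matrix.toLinearMap₂'_apply']

lemma evalCuts_gramForm (H : SimpleGraph (Fin (n + 1))) (b : Sym2 (Fin (n + 1)) → ℝ)
    (S : Finset (Fin (n + 1))) :
    evalCuts n (gramForm (gramMatrix H b)) S =
      incVec S ⬝ᵥ (gramMatrix H b *ᵥ incVec S) := by
  classical
  simp only [evalCuts_apply, gramForm_apply, dotProduct_gramMatrix_mulVec,
    root_dotProduct_centered]

lemma continuous_form_apply (x : zeroSum n) : Continuous fun f : Form n => f x :=
  (continuous_apply x).comp continuous_induced_dom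

lemma continuous_evalCuts : Continuous (evalCuts n) :=
  continuous_pi fun _ => continuous_form_apply _

/-- Quadratic forms as functions. -/
def formToFun (n : ℕ) : Form n →ₗ[ℝ] (zeroSum n → ℝ) where
  toFun f x := f x
  map_add' _ _ := rfl
  map_smul' _ _ := rfl

instance : IsTopologicalAddGroup (Form n) := topologicalAddGroup_induced (formToFun n)

instance : ContinuousSMul ℝ (Form n) := continuousSMul_induced (formToFun n)

instance : T2Space (Form n) := by
  refine T2Space.of_injective_continuous (f := formToFun n) (fun f g h => ?_) continuous_induced_dom
  ext x
  exact congrFun h x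

open scoped Classical in
lemma isRootSum_iff (G : SimpleGraph (Fin (n + 1))) (b : Sym2 (Fin (n + 1)) → ℝ) (f : Form n) :
    IsRootSum G b f ↔ f = ∑ u ∈ G.edgeFinset, b u • rootForm u := by
  simp only [IsRootSum, QuadraticMap.ext_iff, sum_apply, smul_apply,
    rootForm_apply, smul_eq_mul]

open scoped Classical in
lemma graphFace_eq_nonnegCone (G : SimpleGraph (Fin (n + 1))) :
    graphFace G = nonnegCone (fun u : G.edgeSet => rootForm (u : Sym2 (Fin (n + 1)))) := by
  ext f
  simp only [graphFace, isRootSum_iff]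
  exact exists_edge_weights_iff G _ (0 ≤ ·) f

/-- The forms `∑ b_u ⟨t(u), x⟩²` over the edges `u` of `G`, with all `b_u > 0`. -/
def graphDomain (G : SimpleGraph (Fin (n + 1))) : Set (Form n) :=
  {f | ∃ b : Sym2 (Fin (n + 1)) → ℝ, (∀ u ∈ G.edgeSet, 0 < b u) ∧ IsRootSum G b f}

open scoped Classical in
lemma graphDomain_eq_posCone (G : SimpleGraph (Fin (n + 1))) :
    graphDomain G = posCone (fun u : G.edgeSet => rootForm (u : Sym2 (Fin (n + 1)))) := by
  ext f
  simp only [graphDomain, isRootSum_iff]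
  exact exists_edge_weights_iff G _ (0 < ·) f

/-! ### Coordinates on forms and the faces of the closed principal domain -/

/-- The functional on forms that reads off the coefficient of `⟨t(u), x⟩²`. -/
def formCoef (u : Sym2 (Fin (n + 1))) : Form n →ₗ[ℝ] ℝ :=
  edgeCoef u ∘ₗ evalCuts n

lemma formCoef_apply (u : Sym2 (Fin (n + 1))) (f : Form n) :
    formCoef u f = edgeCoef u (evalCuts n f) := rfl

lemma isDualTo_rootForm (G : SimpleGraph (Fin (n + 1))) :
    IsDualTo (fun u : G.edgeSet => formCoef (u : Sym2 (Fin (n + 1))))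
      (fun u : G.edgeSet => rootForm (u : Sym2 (Fin (n + 1)))) := by
  refine ⟨fun u => ?_, fun u v h => ?_⟩
  · rw [formCoef_apply, evalCuts_rootForm]
    exact (isDualTo_cutIndicator G).1 u
  · rw [formCoef_apply, evalCuts_rootForm]
    exact (isDualTo_cutIndicator G).2 u v h

lemma continuous_formCoef (u : Sym2 (Fin (n + 1))) :
    Continuous (formCoef u : Form n → ℝ) :=
  (continuous_edgeCoef u).comp continuous_evalCuts

lemma closure_graphDomain (G : SimpleGraph (Fin (n + 1))) :
    closure (graphDomain G) = graphFace G := by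
  classical
  rw [graphDomain_eq_posCone, graphFace_eq_nonnegCone]
  exact closure_posCone (isDualTo_rootForm G) fun u => continuous_formCoef _

open scoped Classical in
lemma edgeCoef_sum (G : SimpleGraph (Fin (n + 1))) (b : Sym2 (Fin (n + 1)) → ℝ)
    {u : Sym2 (Fin (n + 1))} (hu : u.inf ≠ u.sup) :
    edgeCoef u (∑ v ∈ G.edgeFinset, b v • cutIndicator v) = if u ∈ G.edgeSet then b u else 0 := by
  have h : ∀ v, b v * edgeCoef u (cutIndicator v) = if u = v then b v else 0 := by
    intro v
    split_ifs with h
    · rw [← h, edgeCoef_cutIndicator_self hu, mul_one]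
    · rw [edgeCoef_cutIndicator_of_ne hu h, mul_zero]
  simp [h]

lemma edgeCoef_cutFun (G : SimpleGraph (Fin (n + 1))) (b : Sym2 (Fin (n + 1)) → ℝ)
    {u : Sym2 (Fin (n + 1))} (hu : u.inf ≠ u.sup) [Decidable (u ∈ G.edgeSet)] :
    edgeCoef u (cutFun G b) = if u ∈ G.edgeSet then b u else 0 := by
  classical
  rw [cutFun_eq_sum, edgeCoef_sum G b hu]
  congr

lemma formCoef_nonneg_of_mem_graphFace {G : SimpleGraph (Fin (n + 1))} {f : Form n}
    (hf : f ∈ graphFace G) {u : Sym2 (Fin (n + 1))} (hu : u ∈ G.edgeSet) :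
    0 ≤ formCoef u f := by
  classical
  rw [graphFace_eq_nonnegCone] at hf
  exact ((isDualTo_rootForm G).mem_nonnegCone_iff.1 hf).1 ⟨u, hu⟩

open scoped Classical in
lemma formCoef_sum (G : SimpleGraph (Fin (n + 1))) (b : Sym2 (Fin (n + 1)) → ℝ)
    {u : Sym2 (Fin (n + 1))} (hu : u.inf ≠ u.sup) :
    formCoef u (∑ v ∈ G.edgeFinset, b v • rootForm v) =
      if u ∈ G.edgeSet then b u else 0 := by
  rw [← edgeCoef_sum G b hu]
  simp only [map_sum, map_smul, formCoef_apply, evalCuts_rootForm]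

open scoped Classical in
lemma graphFace_eq_sep {G H : SimpleGraph (Fin (n + 1))} (hGH : G ≤ H) :
    graphFace G = {f ∈ graphFace H |
      ∀ u ∈ H.edgeSet \ G.edgeSet, formCoef u f = 0} := by
  have hsub : G.edgeFinset ⊆ H.edgeFinset := SimpleGraph.edgeFinset_mono hGH
  ext f
  simp only [graphFace, isRootSum_iff, Set.mem_ofPred_eq]
  constructor
  · rintro ⟨b, hb, rfl⟩
    refine ⟨⟨fun u => if u ∈ G.edgeSet then b u else 0, fun u _ => ?_, ?_⟩, fun u hu => ?_⟩
    · dsimp only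
      split_ifs with h
      exacts [hb u h, le_rfl]
    · rw [← Finset.sum_subset hsub]
      · exact Finset.sum_congr rfl fun u hu => by simp [SimpleGraph.mem_edgeFinset.1 hu]
      · intro u _ hu
        rw [SimpleGraph.mem_edgeFinset] at hu
        simp [hu]
    · rw [formCoef_sum G b (inf_ne_sup_of_mem_edgeSet hu.1), if_neg hu.2]
  · rintro ⟨⟨b, hb, rfl⟩, h⟩
    refine ⟨b, fun u hu => hb u (SimpleGraph.edgeSet_mono hGH hu), ?_⟩
    rw [← Finset.sum_subset hsub]
    intro u hu1 hu
    rw [SimpleGraph.mem_edgeFinset] at hu hu1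
    have h0 := h u ⟨hu1, hu⟩
    rw [formCoef_sum H b (inf_ne_sup_of_mem_edgeSet hu1), if_pos hu1] at h0
    rw [h0, zero_smul]

/-- The exposing functional is minus the sum of the coefficients on the edges missing from `G`. Its
maximum on the larger cone is `0`, attained at the zero form, and it vanishes only where all these
coefficients do. -/
lemma isExposed_graphFace {G H : SimpleGraph (Fin (n + 1))} (hGH : G ≤ H) :
    IsExposed ℝ (graphFace H) (graphFace G) := by
  classical
  intro _
  let E := H.edgeFinset \ G.edgeFinset
  have hE : ∀ {u}, u ∈ E ↔ u ∈ H.edgeSet \ G.edgeSet := by simp [E]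
  let l : Form n →L[ℝ] ℝ := ⟨-∑ u ∈ E, formCoef u, by
    have : Continuous fun f : Form n => -∑ u ∈ E, (formCoef u) f :=
      (continuous_finsetSum _ fun u _ => continuous_formCoef u).neg
    convert this using 2
    simp⟩
  have hl : ∀ f, l f = -∑ u ∈ E, formCoef u f := fun f => by
    change (-∑ u ∈ E, formCoef u) f = _
    simp
  have hnn : ∀ f ∈ graphFace H, ∀ u ∈ E, 0 ≤ formCoef u f := fun f hf u hu =>
    formCoef_nonneg_of_mem_graphFace hf (hE.1 hu).1
  have h0 : (0 : Form n) ∈ graphFace H := ⟨0, by simp, fun x => by simp⟩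
  refine ⟨l, ?_⟩
  rw [graphFace_eq_sep hGH]
  ext f
  refine and_congr_right fun hf => ⟨fun h g hg => ?_, fun h => ?_⟩
  · have : l f = 0 := by
      rw [hl, Finset.sum_eq_zero fun u hu => h u (hE.1 hu), neg_zero]
    rw [this, hl, neg_nonpos]
    exact Finset.sum_nonneg (hnn g hg)
  · have h1 := h 0 h0
    rw [map_zero, hl, neg_nonneg] at h1
    have h2 := (Finset.sum_eq_zero_iff_of_nonneg (hnn f hf)).1
      (h1.antisymm (Finset.sum_nonneg (hnn f hf)))
    exact fun u hu => h2 u (hE.2 hu)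

/-! ### The zonotope and the base polytope -/

variable {G H : SimpleGraph (Fin (n + 1))} {b c : Sym2 (Fin (n + 1)) → ℝ}

open scoped Classical in
lemma mem_zonotope_iff {x : Fin (n + 1) → ℝ} :
    x ∈ zonotope G b ↔ ∃ c : Sym2 (Fin (n + 1)) → ℝ,
      (∀ u ∈ G.edgeSet, c u ∈ Set.Icc (-1 : ℝ) 1) ∧
      x = ∑ u ∈ G.edgeFinset, (b u * c u) • root u := by
  rw [zonotope, Set.mem_finsetSum]
  constructor
  · rintro ⟨g, hg, rfl⟩
    have : ∀ u, ∃ c : ℝ, u ∈ G.edgeSet → c ∈ Set.Icc (-1 : ℝ) 1 ∧ g u = (b u * c) • root u := by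
      intro u
      by_cases hu : u ∈ G.edgeSet
      · obtain ⟨_, ⟨c, hc, rfl⟩, h⟩ := hg (SimpleGraph.mem_edgeFinset.2 hu)
        exact ⟨c, fun _ => ⟨hc, by rw [← h, mul_smul]⟩⟩
      · exact ⟨0, fun h => absurd h hu⟩
    choose c hc using this
    exact ⟨c, fun u hu => (hc u hu).1,
      Finset.sum_congr rfl fun u hu => (hc u (SimpleGraph.mem_edgeFinset.1 hu)).2⟩
  · rintro ⟨c, hc, rfl⟩
    exact ⟨fun u => (b u * c u) • root u, fun {u} hu =>
      ⟨c u • root u, ⟨c u, hc u (SimpleGraph.mem_edgeFinset.1 hu), rfl⟩, by simp [mul_smul]⟩, rfl⟩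

lemma convex_isCompact_zonotope : Convex ℝ (zonotope G b) ∧ IsCompact (zonotope G b) := by
  classical
  refine Finset.sum_induction _ (fun s => Convex ℝ s ∧ IsCompact s)
    (fun s t hs ht => ⟨hs.1.add ht.1, hs.2.add ht.2⟩) ⟨convex_singleton 0, isCompact_singleton⟩ ?_
  intro u _
  have : zSegment (root u) = (LinearMap.toSpanSingleton ℝ _ (root u)) '' Set.Icc (-1 : ℝ) 1 := by
    ext x
    simp [zSegment, eq_comm]
  rw [this]
  refine ⟨((convex_Icc (-1 : ℝ) 1).linear_image _).smul _,
    (isCompact_Icc.image ?_).smul _⟩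
  exact continuous_id.smul continuous_const

open scoped Classical in
lemma dotProduct_sum_root (l : Fin (n + 1) → ℝ) (c : Sym2 (Fin (n + 1)) → ℝ) :
    l ⬝ᵥ (∑ u ∈ G.edgeFinset, (b u * c u) • root u) =
      ∑ u ∈ G.edgeFinset, b u * (c u * (root u ⬝ᵥ l)) := by
  rw [dotProduct_sum]
  refine Finset.sum_congr rfl fun u _ => ?_
  rw [dotProduct_smul, smul_eq_mul, dotProduct_comm, mul_assoc]

lemma dotProduct_incVec (x : Fin (n + 1) → ℝ) (S : Finset (Fin (n + 1))) :
    x ⬝ᵥ incVec S = ∑ i ∈ S, x i := by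
  classical
  simp [dotProduct, incVec_apply]

/-- The set `S = N`, excluded in the definition of the polytope, gives `0 ≤ 0`. -/
lemma sum_le_cutFun_of_mem_basePolytope {x : Fin (n + 1) → ℝ}
    (hx : x ∈ basePolytope (cutFun G b)) (S : Finset (Fin (n + 1))) :
    ∑ i ∈ S, x i ≤ cutFun G b S := by
  classical
  rcases (Finset.subset_univ S).eq_or_ssubset with rfl | hS
  · rw [hx.2, cutFun]
    simp [cuts_iff]
  · exact hx.1 S hS

open scoped Classical in
lemma cutFun_apply_eq_abs (S : Finset (Fin (n + 1))) :
    cutFun G b S = ∑ u ∈ G.edgeFinset, b u * |root u ⬝ᵥ incVec S| := by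
  simp [cutFun_eq_sum, Finset.sum_apply, cutIndicator_eq_abs]

open scoped Classical in
/-- The Lovász extension of a cut function bounds the base polytope on nonnegative vectors. -/
lemma dotProduct_le_of_nonneg {x : Fin (n + 1) → ℝ}
    (hx : x ∈ basePolytope (cutFun G b)) (l : Fin (n + 1) → ℝ) (hl : ∀ i, 0 ≤ l i) :
    x ⬝ᵥ l ≤ ∑ u ∈ G.edgeFinset, b u * |root u ⬝ᵥ l| := by
  induction hk : (Finset.univ.filter fun i => 0 < l i).card using Nat.strong_induction_on
    generalizing l with
  | _ k ih =>
  set T := Finset.univ.filter fun i => 0 < l i with hT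
  rcases T.eq_empty_or_nonempty with h0 | hne
  · have : l = 0 := by
      funext i
      by_contra hi
      have : i ∈ T := by simpa [hT] using (hl i).lt_of_ne' hi
      simp [h0] at this
    simp [this]
  obtain ⟨p, hp, hmin⟩ := T.exists_min_image l hne
  have hp0 : 0 < l p := by simpa [hT] using hp
  have hout : ∀ i, i ∉ T → l i = 0 := fun i hi =>
    le_antisymm (by simpa [hT] using hi) (hl i)
  -- Peel off the lowest positive level: `l = l' + l_p e_T`, and the support of `l'` no longer
  -- contains `p`.
  let l' : Fin (n + 1) → ℝ := fun i => if i ∈ T then l i - l p else 0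
  have hl' : ∀ i, 0 ≤ l' i := by
    intro i
    simp only [l']
    split_ifs with h
    · exact sub_nonneg.2 (hmin i h)
    · exact le_rfl
  have hsum : l = l' + l p • incVec T := by
    funext i
    by_cases h : i ∈ T
    · simp [l', incVec_apply, h]
    · simp [l', incVec_apply, h, hout i h]
  have hcard : (Finset.univ.filter fun i => 0 < l' i).card < k := by
    rw [← hk]
    refine Finset.card_lt_card ((Finset.ssubset_iff_of_subset ?_).2 ⟨p, hp, by simp [l']⟩)
    intro i hi
    by_contra h
    simp [l', h] at hi
  have h1 := ih _ hcard l' hl' rfl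
  have h2 := mul_le_mul_of_nonneg_left (sum_le_cutFun_of_mem_basePolytope hx T) hp0.le
  rw [← dotProduct_incVec, cutFun_apply_eq_abs, Finset.mul_sum] at h2
  -- The absolute values add up because `l'` is nonnegative and vanishes off `T`, so `l'` and `e_T`
  -- never differ in opposite directions along an edge.
  have h3 : ∀ u : Sym2 (Fin (n + 1)),
      |root u ⬝ᵥ l| = |root u ⬝ᵥ l'| + l p * |root u ⬝ᵥ incVec T| := by
    intro u
    have e1 := hl' u.inf
    have e2 := hl' u.sup
    simp only [root_dotProduct]
    have f1 := congrFun hsum u.inf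
    have f2 := congrFun hsum u.sup
    simp only [Pi.add_apply, Pi.smul_apply, smul_eq_mul, incVec_apply] at f1 f2 ⊢
    by_cases g1 : u.inf ∈ T <;> by_cases g2 : u.sup ∈ T <;>
      simp only [g1, g2, if_true, if_false, mul_one, mul_zero, add_zero] at f1 f2 ⊢ <;>
      rw [f1, f2]
    · simp
    · have : l' u.sup = 0 := by simp [l', g2]
      rw [this]
      simp [abs_of_nonneg, add_nonneg, e1, hp0.le]
    · have : l' u.inf = 0 := by simp [l', g1]
      rw [this]
      simp only [zero_sub, abs_neg, abs_one, mul_one]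
      rw [abs_of_nonneg e2, abs_of_nonneg (add_nonneg e2 hp0.le)]
    · simp
  calc x ⬝ᵥ l = x ⬝ᵥ l' + l p * (x ⬝ᵥ incVec T) := by
        conv_lhs => rw [hsum]
        simp [dotProduct_add]
    _ ≤ _ := add_le_add h1 h2
    _ = _ := by
        rw [← Finset.sum_add_distrib]
        refine Finset.sum_congr rfl fun u _ => ?_
        rw [h3]
        ring

open scoped Classical in
lemma dotProduct_le_of_mem_basePolytope {x : Fin (n + 1) → ℝ}
    (hx : x ∈ basePolytope (cutFun G b)) (l : Fin (n + 1) → ℝ) :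
    x ⬝ᵥ l ≤ ∑ u ∈ G.edgeFinset, b u * |root u ⬝ᵥ l| := by
  -- Subtracting the minimum makes `l` nonnegative and changes neither side: `x` has sum zero and
  -- the roots ignore constants.
  obtain ⟨m, -, hm⟩ := Finset.univ.exists_min_image l Finset.univ_nonempty
  have h := dotProduct_le_of_nonneg hx (fun i => l i - l m)
    fun i => sub_nonneg.2 (hm i (Finset.mem_univ i))
  have h1 : x ⬝ᵥ (fun i => l i - l m) = x ⬝ᵥ l := by
    simp [dotProduct, mul_sub, ← Finset.sum_mul, hx.2]
  rw [h1] at h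
  simpa [root_dotProduct] using h

lemma apply_eq_dotProduct (f : (Fin (n + 1) → ℝ) →L[ℝ] ℝ) (x : Fin (n + 1) → ℝ) :
    f x = (fun i => f (Pi.single i 1)) ⬝ᵥ x := by
  conv_lhs => rw [← Finset.univ_sum_single x]
  rw [map_sum, dotProduct]
  refine Finset.sum_congr rfl fun i _ => ?_
  have : (Pi.single i (x i) : Fin (n + 1) → ℝ) = x i • Pi.single i 1 := by
    rw [← Pi.single_smul, smul_eq_mul, mul_one]
  rw [this, map_smul, smul_eq_mul, mul_comm]

open scoped Classical in
/-- The point of the zonotope given by the signs of `l` on the roots. -/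
def signPoint (G : SimpleGraph (Fin (n + 1))) (b : Sym2 (Fin (n + 1)) → ℝ)
    (l : Fin (n + 1) → ℝ) : Fin (n + 1) → ℝ :=
  ∑ u ∈ G.edgeFinset, (b u * (SignType.sign (root u ⬝ᵥ l) : ℝ)) • root u

lemma sign_mem_Icc (a : ℝ) : (SignType.sign a : ℝ) ∈ Set.Icc (-1 : ℝ) 1 := by
  rcases lt_trichotomy a 0 with h | rfl | h <;> simp [*]

lemma signPoint_mem_zonotope (l : Fin (n + 1) → ℝ) : signPoint G b l ∈ zonotope G b :=
  mem_zonotope_iff.2 ⟨_, fun _ _ => sign_mem_Icc _, rfl⟩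

open scoped Classical in
lemma dotProduct_signPoint (l : Fin (n + 1) → ℝ) :
    l ⬝ᵥ signPoint G b l = ∑ u ∈ G.edgeFinset, b u * |root u ⬝ᵥ l| := by
  rw [signPoint, dotProduct_sum_root]
  simp

lemma basePolytope_cutFun_eq_zonotope (hb : ∀ u ∈ G.edgeSet, 0 < b u) :
    basePolytope (cutFun G b) = zonotope G b := by
  classical
  apply Set.Subset.antisymm
  · intro x hx
    by_contra hxz
    -- A separating functional would exceed at `x` its value at the sign point, which is the bound
    -- already proved on the base polytope.
    obtain ⟨f, r, hf1, hf2⟩ := geometric_hahn_banach_closed_point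
      (convex_isCompact_zonotope (G := G) (b := b)).1 convex_isCompact_zonotope.2.isClosed hxz
    have h1 := hf1 _ (signPoint_mem_zonotope fun i => f (Pi.single i 1))
    rw [apply_eq_dotProduct] at h1 hf2
    rw [dotProduct_signPoint] at h1
    rw [dotProduct_comm] at hf2
    exact absurd (dotProduct_le_of_mem_basePolytope hx _) (not_le.2 (h1.trans hf2))
  · intro x hx
    obtain ⟨c, hc, rfl⟩ := mem_zonotope_iff.1 hx
    constructor
    · intro S _
      rw [← dotProduct_incVec, dotProduct_comm, dotProduct_sum_root, cutFun_apply_eq_abs]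
      refine Finset.sum_le_sum fun u hu => ?_
      rw [SimpleGraph.mem_edgeFinset] at hu
      refine mul_le_mul_of_nonneg_left ((le_abs_self _).trans ?_) (hb u hu).le
      rw [abs_mul]
      exact mul_le_of_le_one_left (abs_nonneg _) (abs_le.2 (hc u hu))
    · have h := dotProduct_sum_root (G := G) (b := b) 1 c
      simpa only [one_dotProduct, root_dotProduct, Pi.one_apply, sub_self, mul_zero,
        Finset.sum_const_zero] using h

/-! ### The faces of the zonotope -/

/-- The face of the zonotope on which the functional `l` is maximal. -/
def faceAt (G : SimpleGraph (Fin (n + 1))) (b : Sym2 (Fin (n + 1)) → ℝ)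
    (l : Fin (n + 1) → ℝ) : Set (Fin (n + 1) → ℝ) :=
  {x ∈ zonotope G b | ∀ y ∈ zonotope G b, l ⬝ᵥ y ≤ l ⬝ᵥ x}

lemma mul_le_abs_of_mem_Icc {s a : ℝ} (hs : s ∈ Set.Icc (-1 : ℝ) 1) : s * a ≤ |a| := by
  refine (le_abs_self _).trans ?_
  rw [abs_mul]
  exact mul_le_of_le_one_left (abs_nonneg _) (abs_le.2 hs)

-- As each `b_u > 0`, a sum attains the maximum of `l` exactly when every term does.
open scoped Classical in
lemma sum_mem_faceAt_iff (hb : ∀ u ∈ G.edgeSet, 0 < b u)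
    (hc : ∀ u ∈ G.edgeSet, c u ∈ Set.Icc (-1 : ℝ) 1) (l : Fin (n + 1) → ℝ) :
    ∑ u ∈ G.edgeFinset, (b u * c u) • root u ∈ faceAt G b l ↔
      ∀ u ∈ G.edgeSet, c u * (root u ⬝ᵥ l) = |root u ⬝ᵥ l| := by
  have hle : ∀ d : Sym2 (Fin (n + 1)) → ℝ, (∀ u ∈ G.edgeSet, d u ∈ Set.Icc (-1 : ℝ) 1) →
      ∀ u ∈ G.edgeFinset, b u * (d u * (root u ⬝ᵥ l)) ≤ b u * |root u ⬝ᵥ l| := by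
    intro d hd u hu
    rw [SimpleGraph.mem_edgeFinset] at hu
    exact mul_le_mul_of_nonneg_left (mul_le_abs_of_mem_Icc (hd u hu)) (hb u hu).le
  constructor
  · rintro ⟨-, h⟩ u hu
    have h1 := h _ (signPoint_mem_zonotope l)
    rw [dotProduct_signPoint, dotProduct_sum_root] at h1
    have h2 := (Finset.sum_eq_sum_iff_of_le (hle c hc)).1
      ((Finset.sum_le_sum (hle c hc)).antisymm h1) u (SimpleGraph.mem_edgeFinset.2 hu)
    exact mul_left_cancel₀ (hb u hu).ne' h2
  · intro h
    refine ⟨mem_zonotope_iff.2 ⟨c, hc, rfl⟩, fun y hy => ?_⟩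
    obtain ⟨d, hd, rfl⟩ := mem_zonotope_iff.1 hy
    rw [dotProduct_sum_root, dotProduct_sum_root]
    refine (Finset.sum_le_sum (hle d hd)).trans_eq (Finset.sum_congr rfl fun u hu => ?_)
    rw [h u (SimpleGraph.mem_edgeFinset.1 hu)]

lemma signPoint_mem_faceAt (hb : ∀ u ∈ G.edgeSet, 0 < b u) (l : Fin (n + 1) → ℝ) :
    signPoint G b l ∈ faceAt G b l := by
  classical
  exact (sum_mem_faceAt_iff hb (fun _ _ => sign_mem_Icc _) l).2 fun u _ => by simp

/-- The signs of `l` on the edges of `G` refine those of `m`. -/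
def SignLE (G : SimpleGraph (Fin (n + 1))) (l m : Fin (n + 1) → ℝ) : Prop :=
  ∀ u ∈ G.edgeSet, root u ⬝ᵥ m ≠ 0 → SignType.sign (root u ⬝ᵥ l) = SignType.sign (root u ⬝ᵥ m)

lemma mul_eq_abs_iff {s a : ℝ} : s * a = |a| ↔ (a ≠ 0 → s = (SignType.sign a : ℝ)) := by
  rcases lt_trichotomy a 0 with h | rfl | h
  · rw [abs_of_neg h, sign_neg h, ← neg_one_mul a, mul_left_inj' h.ne]
    simp [h.ne]
  · simp
  · rw [abs_of_pos h, sign_pos h, mul_eq_right₀ h.ne']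
    simp [h.ne']

lemma signType_cast_injective : Function.Injective ((↑) : SignType → ℝ) := by
  intro a a' h
  cases a <;> cases a' <;> simp_all <;> norm_num at h

/-- The sign point of `l` tests the inclusion: lying in the face of `m`, it must carry the sign of
`m` on every edge where `m` is nonzero. -/
lemma faceAt_subset_iff (hb : ∀ u ∈ G.edgeSet, 0 < b u) (l m : Fin (n + 1) → ℝ) :
    faceAt G b l ⊆ faceAt G b m ↔ SignLE G l m := by
  classical
  constructor
  · intro h u hu
    have h1 := (sum_mem_faceAt_iff hb (fun _ _ => sign_mem_Icc _) m).1
      (h (signPoint_mem_faceAt hb l)) u hu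
    exact fun hm => signType_cast_injective (mul_eq_abs_iff.1 h1 hm)
  · intro h x hx
    obtain ⟨c, hc, rfl⟩ := mem_zonotope_iff.1 hx.1
    rw [sum_mem_faceAt_iff hb hc] at hx ⊢
    intro u hu
    rw [mul_eq_abs_iff]
    intro hm
    have h2 := h u hu hm
    rw [← h2]
    refine mul_eq_abs_iff.1 (hx u hu) fun h0 => hm ?_
    rw [h0, sign_zero, eq_comm, sign_eq_zero_iff] at h2
    exact h2

/-- The functional `x ↦ ⟨l, x⟩`. -/
def dotFunctional (l : Fin (n + 1) → ℝ) : (Fin (n + 1) → ℝ) →L[ℝ] ℝ :=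
  ∑ i, l i • ContinuousLinearMap.proj i

lemma dotFunctional_apply (l x : Fin (n + 1) → ℝ) : dotFunctional l x = l ⬝ᵥ x := by
  simp [dotFunctional, dotProduct]

/-- All faces of the zonotope, `none` standing for the empty face. -/
def toFace (G : SimpleGraph (Fin (n + 1))) (b : Sym2 (Fin (n + 1)) → ℝ) :
    Option (Fin (n + 1) → ℝ) → Face (zonotope G b)
  | none => ⟨∅, fun h => absurd h Set.not_nonempty_empty⟩
  | some l => ⟨faceAt G b l, fun _ => ⟨dotFunctional l, by simp only [dotFunctional_apply]; rfl⟩⟩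

lemma toFace_surjective : Function.Surjective (toFace G b) := by
  rintro ⟨F, hF⟩
  rcases F.eq_empty_or_nonempty with rfl | hne
  · exact ⟨none, rfl⟩
  · obtain ⟨f, rfl⟩ := hF hne
    refine ⟨some fun i => f (Pi.single i 1), Subtype.ext ?_⟩
    change faceAt G b _ = _
    simp only [faceAt, ← apply_eq_dotProduct]

/-- The order of the faces in terms of the functionals that define them. -/
def FaceLE (G : SimpleGraph (Fin (n + 1))) : (x y : Option (Fin (n + 1) → ℝ)) → Prop
  | none, _ => True
  | some _, none => False
  | some l, some m => SignLE G l m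

lemma toFace_le_iff (hb : ∀ u ∈ G.edgeSet, 0 < b u) (x y : Option (Fin (n + 1) → ℝ)) :
    toFace G b x ≤ toFace G b y ↔ FaceLE G x y := by
  rcases x with _ | l
  · exact iff_of_true (Set.empty_subset _) trivial
  rcases y with _ | m
  · exact iff_of_false (fun h => h (signPoint_mem_faceAt hb l)) id
  · exact faceAt_subset_iff hb l m

lemma toFace_eq_iff (hb : ∀ u ∈ G.edgeSet, 0 < b u) (x y : Option (Fin (n + 1) → ℝ)) :
    toFace G b x = toFace G b y ↔ FaceLE G x y ∧ FaceLE G y x := by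
  rw [le_antisymm_iff, toFace_le_iff hb, toFace_le_iff hb]

/-- Both orders are the quotient of one and the same preorder on `X`. -/
lemma nonempty_orderIso_of_surjective {X A B : Type*} [PartialOrder A] [PartialOrder B]
    {f : X → A} {g : X → B} (hf : f.Surjective) (hg : g.Surjective)
    (h : ∀ x y, f x ≤ f y ↔ g x ≤ g y) : Nonempty (A ≃o B) := by
  let e : A ↪o B := OrderEmbedding.ofMapLEIff (fun a => g (Function.surjInv hf a)) fun a a' => by
    rw [← h, Function.surjInv_eq hf, Function.surjInv_eq hf]
  refine ⟨RelIso.ofSurjective e fun y => ?_⟩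
  obtain ⟨x, rfl⟩ := hg y
  refine ⟨f x, le_antisymm ?_ ?_⟩
  · exact (h _ _).1 (Function.surjInv_eq hf (f x)).le
  · exact (h _ _).1 (Function.surjInv_eq hf (f x)).ge

lemma sameType_zonotope (hb : ∀ u ∈ G.edgeSet, 0 < b u) (hc : ∀ u ∈ G.edgeSet, 0 < c u) :
    SameType (zonotope G b) (zonotope G c) :=
  nonempty_orderIso_of_surjective toFace_surjective toFace_surjective fun x y => by
    rw [toFace_le_iff hb, toFace_le_iff hc]

lemma FaceLE.mono (hHG : H ≤ G) {x y : Option (Fin (n + 1) → ℝ)} (h : FaceLE G x y) :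
    FaceLE H x y := by
  rcases x with _ | l
  · trivial
  rcases y with _ | m
  · exact h
  · exact fun u hu => h u (SimpleGraph.edgeSet_mono hHG hu)

/-- A nonempty face is determined by a sign vector, and there are finitely many of these. -/
lemma finite_face_zonotope (hb : ∀ u ∈ G.edgeSet, 0 < b u) : Finite (Face (zonotope G b)) := by
  let s : (Fin (n + 1) → ℝ) → Sym2 (Fin (n + 1)) → SignType :=
    fun l u => SignType.sign (root u ⬝ᵥ l)
  refine Finite.of_injective
    (fun F => (Function.surjInv (toFace_surjective (G := G) (b := b)) F).map s) fun F F' h => ?_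
  rw [← Function.surjInv_eq (toFace_surjective (G := G) (b := b)) F,
    ← Function.surjInv_eq (toFace_surjective (G := G) (b := b)) F', toFace_eq_iff hb]
  dsimp only at h
  generalize Function.surjInv toFace_surjective F = x at h ⊢
  generalize Function.surjInv toFace_surjective F' = y at h ⊢
  rcases x with _ | l <;> rcases y with _ | m
  · exact ⟨trivial, trivial⟩
  · simp at h
  · simp at h
  · have h' : s l = s m := by simpa using h
    exact ⟨fun u _ _ => congrFun h' u, fun u _ _ => (congrFun h' u).symm⟩

/-- Deleting edges makes two faces collide. -/
lemma exists_collision (hHG : H < G) :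
    ∃ x y, FaceLE H x y ∧ FaceLE H y x ∧ ¬FaceLE G x y := by
  obtain ⟨i, j, hG, hH⟩ : ∃ i j, G.Adj i j ∧ ¬H.Adj i j := by
    by_contra! h
    exact hHG.not_ge fun i j => h i j
  have hij : i ≠ j := hG.ne
  -- All vertices other than `i` keep distinct integer heights. Raising `i` from the height of `j`
  -- by `1 / 2` passes no other vertex, so only the sign on the pair `i`, `j` changes.
  let l : Fin (n + 1) → ℝ := fun k => if k = i then (j : ℝ) else k
  let m : Fin (n + 1) → ℝ := fun k => if k = i then (j : ℝ) + 1 / 2 else k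
  have key : ∀ p q : Fin (n + 1), s(p, q) ≠ s(i, j) →
      SignType.sign (l p - l q) = SignType.sign (m p - m q) := by
    intro p q hpq
    have aux : ∀ q : Fin (n + 1), q ≠ j →
        SignType.sign ((j : ℝ) - q) = SignType.sign ((j : ℝ) + 1 / 2 - q) := by
      intro q hq
      rcases lt_or_gt_of_ne hq with h | h
      · have : (q : ℝ) < j := by exact_mod_cast h
        rw [sign_pos (by linarith), sign_pos (by linarith)]
      · have : (j : ℝ) + 1 ≤ q := by exact_mod_cast h
        rw [sign_neg (by linarith), sign_neg (by linarith)]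
    by_cases hp : p = i <;> by_cases hq : q = i
    · simp [hp, hq]
    · have : q ≠ j := fun h => hpq (by rw [hp, h])
      simp only [l, m, hp, hq, if_true, if_false]
      exact aux q this
    · have : p ≠ j := fun h => hpq (by rw [hq, h, Sym2.eq_swap])
      simp only [l, m, hp, hq, if_true, if_false]
      have := aux p this
      rw [← neg_sub (j : ℝ), ← neg_sub ((j : ℝ) + 1 / 2), Left.sign_neg, Left.sign_neg, this]
    · simp [l, m, hp, hq]
  have hs : ∀ u ∈ H.edgeSet, SignType.sign (root u ⬝ᵥ l) = SignType.sign (root u ⬝ᵥ m) := by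
    intro u hu
    rw [root_dotProduct, root_dotProduct]
    refine key _ _ fun h => hH ?_
    rw [mk_inf_sup] at h
    rwa [h] at hu
  refine ⟨some l, some m, fun u hu _ => hs u hu, fun u hu _ => (hs u hu).symm, fun h => ?_⟩
  have h1 := h s(i, j) hG
  simp only [root_dotProduct] at h1
  have h2 : ∀ f : Fin (n + 1) → ℝ, f s(i, j).inf - f s(i, j).sup = f i - f j ∨
      f s(i, j).inf - f s(i, j).sup = -(f i - f j) := by
    intro f
    rcases le_total i j with h | h <;> simp [h]
  have hl : l s(i, j).inf - l s(i, j).sup = 0 := by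
    rcases h2 l with h | h <;> rw [h] <;> simp [l]
  have hm : m s(i, j).inf - m s(i, j).sup ≠ 0 := by
    rcases h2 m with h | h <;> rw [h] <;> simp [m, hij.symm]
  have h3 := h1 hm
  rw [hl, sign_zero, eq_comm, sign_eq_zero_iff] at h3
  exact hm h3

/-- Sending the face of `l` for `G` to the face of `l` for `H` is well defined and onto, but not
injective by `exists_collision`. An isomorphism of the finite face lattices would force injectivity.
-/
lemma not_sameType_of_lt (hHG : H < G) (hb : ∀ u ∈ G.edgeSet, 0 < b u)
    (hc : ∀ u ∈ H.edgeSet, 0 < c u) : ¬SameType (zonotope G b) (zonotope H c) := by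
  rintro ⟨e⟩
  have hs := toFace_surjective (G := G) (b := b)
  let φ : Face (zonotope G b) → Face (zonotope H c) := fun F => toFace H c (Function.surjInv hs F)
  have hφ : ∀ x, φ (toFace G b x) = toFace H c x := by
    intro x
    have h := (toFace_eq_iff hb _ _).1 (Function.surjInv_eq hs (toFace G b x))
    exact (toFace_eq_iff hc _ _).2 ⟨h.1.mono hHG.le, h.2.mono hHG.le⟩
  have hφs : Function.Surjective φ := fun F => by
    obtain ⟨x, rfl⟩ := toFace_surjective F
    exact ⟨_, hφ x⟩
  have := finite_face_zonotope hc
  have hinj : Function.Injective (φ ∘ e.symm) :=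
    Finite.injective_iff_surjective.2 (hφs.comp e.symm.surjective)
  have hφi : Function.Injective φ := fun F F' h => by
    have := @hinj (e F) (e F') (by simpa using h)
    exact e.injective this
  obtain ⟨x, y, h1, h2, h3⟩ := exists_collision hHG
  have : toFace G b x = toFace G b y := hφi <| by
    rw [hφ, hφ, toFace_eq_iff hc]
    exact ⟨h1, h2⟩
  exact h3 ((toFace_eq_iff hb _ _).1 this).1

/-! ### Type domains -/

lemma cutFun_eq_of_le (hHG : H ≤ G) (h1 : ∀ u ∈ H.edgeSet, b u = c u)
    (h2 : ∀ u ∈ G.edgeSet \ H.edgeSet, c u = 0) : cutFun H b = cutFun G c := by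
  classical
  rw [cutFun_eq_sum, cutFun_eq_sum, ← Finset.sum_subset (SimpleGraph.edgeFinset_mono hHG)]
  · exact Finset.sum_congr rfl fun u hu => by rw [h1 u (SimpleGraph.mem_edgeFinset.1 hu)]
  · intro u hu hu'
    rw [SimpleGraph.mem_edgeFinset] at hu hu'
    rw [h2 u ⟨hu, hu'⟩, zero_smul]

lemma exists_mem_cutCone_of_mem_cutFunctions {β : SetFun n} (hβ : β ∈ cutFunctions n) :
    ∃ (H : SimpleGraph (Fin (n + 1))) (c : Sym2 (Fin (n + 1)) → ℝ),
      (∀ u ∈ H.edgeSet, 0 < c u) ∧ β = cutFun H c := by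
  obtain ⟨b, hb, rfl⟩ := hβ
  -- The graph is the support of the weights.
  refine ⟨SimpleGraph.fromEdgeSet {u | 0 < b u}, b, fun u hu => ?_, ?_⟩
  · rw [SimpleGraph.edgeSet_fromEdgeSet] at hu
    exact hu.1
  · refine (cutFun_eq_of_le le_top (fun _ _ => rfl) fun u hu => ?_).symm
    have h0 : ¬0 < b u := fun h => hu.2 <| by
      rw [SimpleGraph.edgeSet_fromEdgeSet]
      exact ⟨h, SimpleGraph.not_isDiag_of_mem_edgeSet _ hu.1⟩
    exact (not_lt.1 h0).antisymm (hb u hu.1)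

lemma cutCone_subset_cutFunctions : cutCone G ⊆ cutFunctions n := by
  classical
  rintro _ ⟨b, hb, rfl⟩
  refine ⟨fun u => if u ∈ G.edgeSet then b u else 0, fun u _ => ?_,
    cutFun_eq_of_le le_top (fun u hu => (if_pos hu).symm) fun u hu => if_neg hu.2⟩
  dsimp only
  split_ifs with h
  exacts [(hb u h).le, le_rfl]

lemma typeDomain_cutFun (hb : ∀ u ∈ G.edgeSet, 0 < b u) :
    typeDomain (cutFun G b) = cutCone G := by
  classical
  set T := {β ∈ cutFunctions n | SameType (basePolytope β) (basePolytope (cutFun G b))} with hT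
  have hmem : cutFun G b ∈ cutCone G := ⟨b, hb, rfl⟩
  have hsub : cutCone G ⊆ T := by
    intro β hβ
    refine ⟨cutCone_subset_cutFunctions hβ, ?_⟩
    obtain ⟨c, hc, rfl⟩ := hβ
    rw [basePolytope_cutFun_eq_zonotope hb, basePolytope_cutFun_eq_zonotope hc]
    exact sameType_zonotope hc hb
  have hpre : IsPreconnected (cutCone G) := by
    rw [cutCone_eq_posCone]
    exact (convex_posCone _).isPreconnected
  refine Set.Subset.antisymm ?_ (hpre.subset_connectedComponentIn hmem hsub)
  -- In `T`, the open set `U` leaves only graphs containing `G`, and the closed set `K` only graphs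
  -- contained in `G`. Equality of types then forces the graph to be `G`, so `T ∩ U = T ∩ K =
  -- cutCone G`.
  let U : Set (SetFun n) := {β | ∀ u ∈ G.edgeSet, 0 < edgeCoef u β}
  let K : Set (SetFun n) :=
    {β | ∀ u ∈ (⊤ : SimpleGraph (Fin (n + 1))).edgeSet \ G.edgeSet, edgeCoef u β = 0}
  have hU : IsOpen U := by
    simp only [U, Set.ofPred_forall]
    exact isOpen_iInter_of_finite fun u => isOpen_iInter_of_finite fun _ =>
      isOpen_lt continuous_const (continuous_edgeCoef u)
  have hK : IsClosed K := by
    simp only [K, Set.ofPred_forall]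
    exact isClosed_iInter fun u => isClosed_iInter fun _ =>
      isClosed_eq (continuous_edgeCoef u) continuous_const
  have hCU : cutCone G ⊆ U := by
    rintro _ ⟨c, hc, rfl⟩ u hu
    rw [edgeCoef_cutFun G c (inf_ne_sup_of_mem_edgeSet hu), if_pos hu]
    exact hc u hu
  have hCK : cutCone G ⊆ K := by
    rintro _ ⟨c, hc, rfl⟩ u hu
    rw [edgeCoef_cutFun G c (inf_ne_sup_of_mem_edgeSet hu.1), if_neg hu.2]
  have hTU : T ∩ U ⊆ cutCone G := by
    rintro β ⟨⟨hβ, ht⟩, hβU⟩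
    obtain ⟨H, c, hc, rfl⟩ := exists_mem_cutCone_of_mem_cutFunctions hβ
    rw [basePolytope_cutFun_eq_zonotope hb, basePolytope_cutFun_eq_zonotope hc] at ht
    have hle : G ≤ H := by
      rw [← SimpleGraph.edgeSet_subset_edgeSet]
      intro u hu
      by_contra h
      have := hβU u hu
      rw [edgeCoef_cutFun H c (inf_ne_sup_of_mem_edgeSet hu), if_neg h] at this
      exact lt_irrefl _ this
    rcases hle.eq_or_lt with rfl | hlt
    · exact ⟨c, hc, rfl⟩
    · exact absurd ht (not_sameType_of_lt hlt hc hb)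
  have hTK : T ∩ K ⊆ cutCone G := by
    rintro β ⟨⟨hβ, ht⟩, hβK⟩
    obtain ⟨H, c, hc, rfl⟩ := exists_mem_cutCone_of_mem_cutFunctions hβ
    rw [basePolytope_cutFun_eq_zonotope hb, basePolytope_cutFun_eq_zonotope hc] at ht
    have hle : H ≤ G := by
      rw [← SimpleGraph.edgeSet_subset_edgeSet]
      intro u hu
      by_contra h
      have := hβK u ⟨SimpleGraph.edgeSet_mono le_top hu, h⟩
      rw [edgeCoef_cutFun H c (inf_ne_sup_of_mem_edgeSet hu), if_pos hu] at this
      exact (hc u hu).ne' this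
    rcases hle.eq_or_lt with rfl | hlt
    · exact ⟨c, hc, rfl⟩
    · exact absurd (ht.map OrderIso.symm) (not_sameType_of_lt hlt hb hc)
  have hDT : typeDomain (cutFun G b) ⊆ T := connectedComponentIn_subset _ _
  intro β hβ
  by_contra hn
  have hcover : typeDomain (cutFun G b) ⊆ U ∪ Kᶜ := by
    intro γ hγ
    by_cases h : γ ∈ K
    · exact Or.inl (hCU (hTK ⟨hDT hγ, h⟩))
    · exact Or.inr h
  -- A point of the component outside the cone would lie in `Kᶜ`; connectedness then yields a point
  -- in both `U` and `Kᶜ`, although `T ∩ U ⊆ K`.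
  obtain ⟨γ, hγ, hγU, hγK⟩ := isPreconnected_connectedComponentIn U Kᶜ hU hK.isOpen_compl hcover
    ⟨_, mem_connectedComponentIn (hsub hmem), hCU hmem⟩
    ⟨β, hβ, fun h => hn (hTK ⟨hDT hβ, h⟩)⟩
  exact hγK (hCK (hTU ⟨hDT hγ, hγU⟩))

end CutCone

end

open scoped Classical in
theorem mainTheorem2 (n : ℕ) (G : SimpleGraph (Fin (n + 1))) :
    -- the members of the cone are submodular
    (∀ β ∈ CutCone.cutCone G, CutCone.IsSubmodular β) ∧
    -- the cone is simplicial, spanned by the functions `δ_u`, and open in its linear hull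
    LinearIndependent ℝ (fun u : G.edgeSet => CutCone.cutIndicator (u : Sym2 (Fin (n + 1)))) ∧
    CutCone.cutCone G = {β | ∃ c : G.edgeSet → ℝ, (∀ u, 0 < c u) ∧
      β = ∑ u, c u • CutCone.cutIndicator (u : Sym2 (Fin (n + 1)))} ∧
    intrinsicInterior ℝ (CutCone.cutCone G) = CutCone.cutCone G ∧
    CutCone.affDim (CutCone.cutCone G) = G.edgeSet.ncard ∧
    -- the type domain and the non-rigidity degree of the zonotope
    (∀ b : Sym2 (Fin (n + 1)) → ℝ, (∀ u ∈ G.edgeSet, 0 < b u) →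
      CutCone.basePolytope (CutCone.cutFun G b) = CutCone.zonotope G b ∧
      CutCone.typeDomain (CutCone.cutFun G b) = CutCone.cutCone G ∧
      CutCone.nonRigidityDegree (CutCone.cutFun G b) = G.edgeSet.ncard) ∧
    -- the correspondence with a face of the closed principal domain
    (∀ (b : Sym2 (Fin (n + 1)) → ℝ) (S : Finset (Fin (n + 1))),
      CutCone.cutFun G b S =
        CutCone.incVec S ⬝ᵥ (CutCone.gramMatrix G b *ᵥ CutCone.incVec S)) ∧
    IsExposed ℝ (closure (CutCone.principalDomain n)) (CutCone.graphFace G) ∧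
    ∃ Φ : CutCone.Form n →ₗ[ℝ] CutCone.SetFun n,
      (∀ (H : SimpleGraph (Fin (n + 1))) (b : Sym2 (Fin (n + 1)) → ℝ)
        (S : Finset (Fin (n + 1))),
        Φ (CutCone.gramForm (CutCone.gramMatrix H b)) S =
          CutCone.incVec S ⬝ᵥ (CutCone.gramMatrix H b *ᵥ CutCone.incVec S)) ∧
      Set.BijOn Φ (CutCone.graphFace G) (closure (CutCone.cutCone G)) ∧
      Set.BijOn Φ (intrinsicInterior ℝ (CutCone.graphFace G)) (CutCone.cutCone G) := by
  have hT : ∀ b : Sym2 (Fin (n + 1)) → ℝ, (∀ u ∈ G.edgeSet, 0 < b u) →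
      CutCone.typeDomain (CutCone.cutFun G b) = CutCone.cutCone G :=
    fun b hb => CutCone.typeDomain_cutFun hb
  have hdim : CutCone.affDim (CutCone.cutCone G) = G.edgeSet.ncard := by
    rw [CutCone.cutCone_eq_posCone,
      CutCone.affDim_posCone (CutCone.isDualTo_cutIndicator G).linearIndependent,
      ← Nat.card_coe_set_eq, Nat.card_eq_fintype_card]
  have hk : ∀ u : G.edgeSet, Continuous (CutCone.edgeCoef (u : Sym2 (Fin (n + 1)))) :=
    fun u => CutCone.continuous_edgeCoef _
  refine ⟨fun β hβ => CutCone.isSubmodular_of_mem_cutCone hβ,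
    (CutCone.isDualTo_cutIndicator G).linearIndependent, CutCone.cutCone_eq_posCone G, ?_, hdim,
    fun b hb => ⟨CutCone.basePolytope_cutFun_eq_zonotope hb, hT b hb, ?_⟩,
    CutCone.cutFun_eq_gram G, ?_, CutCone.evalCuts n, CutCone.evalCuts_gramForm, ?_, ?_⟩
  · rw [CutCone.cutCone_eq_posCone]
    exact CutCone.intrinsicInterior_posCone (CutCone.isDualTo_cutIndicator G) hk
  · rw [CutCone.nonRigidityDegree, hT b hb, hdim]
  -- The principal domain is by definition `graphDomain ⊤`.
  · have h : closure (CutCone.principalDomain n) = CutCone.graphFace ⊤ :=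
      CutCone.closure_graphDomain ⊤
    rw [h]
    exact CutCone.isExposed_graphFace le_top
  · rw [CutCone.cutCone_eq_posCone, CutCone.graphFace_eq_nonnegCone,
      CutCone.closure_posCone (CutCone.isDualTo_cutIndicator G) hk]
    exact (CutCone.isDualTo_cutIndicator G).bijOn_nonnegCone fun u =>
      CutCone.evalCuts_rootForm u.1
  · rw [CutCone.cutCone_eq_posCone, CutCone.graphFace_eq_nonnegCone,
      CutCone.intrinsicInterior_nonnegCone (CutCone.isDualTo_rootForm G) fun u =>
        CutCone.continuous_formCoef _]
    exact (CutCone.isDualTo_cutIndicator G).bijOn_posCone fun u => CutCone.evalCuts_rootForm u.1
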